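/- A $0$-$1$ matrix $M$ \emph{contains} a $0$-$1$ matrix $P$ if some submatrix of $M$ (obtained by deleting rows and columns) either equals $P$ or can be turned into $P$ by changing some ones to zeroes; otherwise $M$ \emph{avoids} $P$. Let $\mathrm{ex}(n,P)$ be the maximum number of ones in an $n\times n$ $0$-$1$ matrix that avoids $P$ (and $0$ if no $n\times n$ matrix avoids $P$). A $0$-$1$ matrix $P$ is called \emph{minimally non-linear} if $\mathrm{ex}(n,P)=\omega(n)$ as $n\to\infty$, but $\mathrm{ex}(n,P')=O(n)$ for every $0$-$1$ matrix $P'$ (of any dimensions) that is contained in $P$ but not equal to $P$. **Theorem.** Every minimally non-linear $0$-$1$ matrix with $k$ rows has at most $4k-4$ ones. -/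

import Mathlib

open Filter Asymptotics

/-- A 0-1 matrix with `k` rows and `l` columns (`true` stands for a one, `false` for a zero). -/
abbrev ZeroOneMatrix (k l : ℕ) : Type := Matrix (Fin k) (Fin l) Bool

namespace ZeroOneMatrix

/-- The number of ones of a 0-1 matrix. -/
def ones {k l : ℕ} (M : ZeroOneMatrix k l) : ℕ :=
  (Finset.univ.filter fun p : Fin k × Fin l => M p.1 p.2 = true).card

/-- `M` contains `P`: some submatrix of `M` (obtained by choosing rows and columns, and keeping
their order) equals `P` or can be turned into `P` by changing some ones to zeroes. -/
def Contains {m n k l : ℕ} (M : ZeroOneMatrix m n) (P : ZeroOneMatrix k l) : Prop :=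
  ∃ (f : Fin k ↪o Fin m) (g : Fin l ↪o Fin n),
    ∀ i j, P i j = true → M (f i) (g j) = true

/-- `M` avoids `P`. -/
def Avoids {m n k l : ℕ} (M : ZeroOneMatrix m n) (P : ZeroOneMatrix k l) : Prop :=
  ¬ M.Contains P

/-- The extremal function: the maximum number of ones in an `n × n` 0-1 matrix that avoids `P`
(and `0` if there is no such matrix). The set is bounded above by `n * n`. -/
noncomputable def ex {k l : ℕ} (n : ℕ) (P : ZeroOneMatrix k l) : ℕ :=
  sSup {s : ℕ | ∃ M : ZeroOneMatrix n n, M.Avoids P ∧ M.ones = s}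

/-- `ex(n, P) = O(n)`. -/
def IsLinear {k l : ℕ} (P : ZeroOneMatrix k l) : Prop :=
  (fun n : ℕ => (ex n P : ℝ)) =O[atTop] (fun n : ℕ => (n : ℝ))

/-- `ex(n, P) = ω(n)`. -/
def IsSuperlinear {k l : ℕ} (P : ZeroOneMatrix k l) : Prop :=
  (fun n : ℕ => (n : ℝ)) =o[atTop] (fun n : ℕ => (ex n P : ℝ))

/-- `P` is minimally non-linear: `ex(n, P) = ω(n)`, but `ex(n, P') = O(n)` for every 0-1 matrix
`P'` (of any dimensions) that is contained in `P` but not equal to `P`. -/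
def IsMinimallyNonlinear {k l : ℕ} (P : ZeroOneMatrix k l) : Prop :=
  IsSuperlinear P ∧
    ∀ (k' l' : ℕ) (P' : ZeroOneMatrix k' l'), P.Contains P' →
      (⟨k', l', P'⟩ : Σ (a b : ℕ), ZeroOneMatrix a b) ≠ ⟨k, l, P⟩ → IsLinear P'

end ZeroOneMatrix

/-! Two rows alternating in columns a₁ ≤ b₁ < a₂ ≤ b₂ already form a non-linear pattern with four
ones, so a minimally non-linear P with more than four ones has no such pair of rows
(`not_crossing`). Deleting any one of P leaves a linear pattern. If the deleted one lies in a
stretch of columns whose ones all belong to its row, linearity passes back to P: thin out each row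
of a large matrix, find the smaller pattern there, and refill the stretch from the full row
(`isLinear_of_contains_sparsening`, `contains_of_patch`). Hence P has no such stretch.

Read column by column, the ones of P then spell a word of row labels without abab, without three
equal consecutive letters, and without an equal pair at either end. A count of first occurrences and
repetitions bounds its length by 4k-4 (`word_length_le`).

Non-linearity of the alternations comes from a recursive construction in the style of the lower
bounds for Davenport–Schinzel sequences. `compose` inserts a copy of an inner array before every
marked column of an outer one, so that each outer row gains a one and each inner marked column gains
a one. Iterating it gives t ones in every row with no more columns than rows, for every t. -/

namespace ZeroOneMatrix

/-! ### Marked arrays -/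

/-- A finite 0-1 array, with rows `R` and columns `C` (ordered by `pos`), and a family `S` of
marked columns with `m` ones each, such that every row has at least `t` ones, exactly one of them
in a marked column, and this is its leftmost one. Two rows `a < b` never have ones in columns
`a₁, a₂` and `b₁, b₂` with `a₁ ≤ b₁ < a₂ ≤ b₂`. -/
structure MarkedArray (t m : ℕ) where
  R : Type
  S : Type
  C : Type
  L : Type
  [linR : LinearOrder R]
  [linS : LinearOrder S]
  [linL : LinearOrder L]
  [finR : Fintype R]
  [finS : Fintype S]
  [finC : Fintype C]
  pos : C → L
  pos_inj : Function.Injective pos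
  col : S → C
  col_mono : StrictMono fun s => pos (col s)
  mark : R → S
  One : R → C → Prop
  one_mark : ∀ r, One r (col (mark r))
  leftmost : ∀ r c, One r c → pos (col (mark r)) ≤ pos c
  mark_unique : ∀ r s, One r (col s) → s = mark r
  card_fiber : ∀ s, Nat.card {r // mark r = s} = m
  le_degree : ∀ r, t ≤ Nat.card {c // One r c}
  free : ∀ a b, a < b → ∀ a₁ b₁ a₂ b₂, One a a₁ → One b b₁ → One a a₂ → One b b₂ →
    pos a₁ ≤ pos b₁ → pos b₁ < pos a₂ → pos a₂ ≤ pos b₂ → False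

namespace MarkedArray

attribute [instance] linR linS linL finR finS finC

theorem card_rows {t m : ℕ} (X : MarkedArray t m) :
    Fintype.card X.R = m * Fintype.card X.S := by
  classical
  rw [← Fintype.card_congr (Equiv.sigmaFiberEquiv X.mark), Fintype.card_sigma]
  have : ∀ s, Fintype.card {r // X.mark r = s} = m := fun s => by
    rw [← Nat.card_eq_fintype_card]; exact X.card_fiber s
  simp [this, mul_comm]

/-- The array with a single column, full of ones. -/
def singleColumn (m : ℕ) : MarkedArray 0 m where
  R := Fin m
  S := Unit
  C := Unit
  L := Unit
  pos := id
  pos_inj := fun _ _ h => h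
  col := id
  col_mono := fun a b h => h
  mark := fun _ => ()
  One := fun _ _ => True
  one_mark := fun _ => trivial
  leftmost := fun _ _ _ => le_rfl
  mark_unique := fun _ _ _ => rfl
  card_fiber := fun s => by simp
  le_degree := fun _ => Nat.zero_le _
  free := fun a b _ a₁ b₁ a₂ b₂ _ _ _ _ _ h _ => absurd h (lt_irrefl _)

/-- `N` rows with `t + 1` ones each, in disjoint intervals of columns. -/
def disjointRows (t N : ℕ) : MarkedArray (t + 1) 1 where
  R := Fin N
  S := Fin N
  C := Fin N × Fin (t + 1)
  L := Fin N ×ₗ Fin (t + 1)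
  pos := toLex
  pos_inj := toLex.injective
  col := fun s => (s, 0)
  col_mono := fun a b h => by
    simp only [Prod.Lex.toLex_lt_toLex]; exact Or.inl h
  mark := id
  One := fun r c => c.1 = r
  one_mark := fun _ => rfl
  leftmost := fun r c h => by
    subst h
    simp only [Prod.Lex.toLex_le_toLex]; right; simp
  mark_unique := fun r s h => h
  card_fiber := fun s => by simp
  le_degree := fun r => by
    have := Nat.card_le_card_of_injective
      (fun i : Fin (t + 1) => (⟨(r, i), rfl⟩ : {c : Fin N × Fin (t + 1) // c.1 = r}))
      (fun i j h => by simpa using h)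
    simpa using this
  free := by
    rintro a b hab ⟨_, a₁⟩ ⟨_, b₁⟩ ⟨_, a₂⟩ ⟨_, b₂⟩ rfl rfl h h' _ h₂ _
    simp only at h h' hab h₂
    subst h h'
    simp only [Prod.Lex.toLex_lt_toLex] at h₂
    rcases h₂ with h₂ | h₂
    · exact lt_asymm hab h₂
    · exact hab.ne' h₂.1

/-- The rows of a fibre of `mark` can be matched, in reverse order, with any linear order of the
right size. -/
theorem exists_reverse_matching {t s : ℕ} (X : MarkedArray t s) (T : Type) [LinearOrder T]
    [Fintype T] (hT : Fintype.card T = s) :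
    ∃ φ : X.R → T, (∀ r r', X.mark r = X.mark r' → r < r' → φ r' < φ r) ∧
      ∀ s x, ∃ r, X.mark r = s ∧ φ r = x := by
  classical
  have e : ∀ s, Nonempty ({r // X.mark r = s} ≃o Tᵒᵈ) := fun s => by
    have h₁ : Fintype.card {r // X.mark r = s} = Fintype.card Tᵒᵈ := by
      rw [← Nat.card_eq_fintype_card, X.card_fiber, Fintype.card_orderDual, hT]
    exact ⟨(Fintype.orderIsoFinOfCardEq _ h₁).symm.trans (Fintype.orderIsoFinOfCardEq Tᵒᵈ rfl)⟩
  obtain ⟨e⟩ := Classical.nonempty_pi.2 e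
  have key : ∀ s (x : {r // X.mark r = s}),
      OrderDual.ofDual (e (X.mark x.1) ⟨x.1, rfl⟩) = OrderDual.ofDual (e s x) := by
    rintro s ⟨r, rfl⟩; rfl
  refine ⟨fun r => OrderDual.ofDual (e (X.mark r) ⟨r, rfl⟩), fun r r' h hr => ?_, fun s x => ?_⟩
  · have h₁ := key (X.mark r') ⟨r, h⟩
    simp only at h₁ ⊢
    rw [h₁]
    exact (e (X.mark r')).strictMono (a := ⟨r, h⟩) (b := ⟨r', rfl⟩) hr
  · refine ⟨((e s).symm (OrderDual.toDual x)).1, ((e s).symm (OrderDual.toDual x)).2, ?_⟩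
    have := key s ((e s).symm (OrderDual.toDual x))
    simpa using this

/-! ### Composition of marked arrays -/

section Compose

variable {t m s : ℕ} (X : MarkedArray (t + 1) m) (Y : MarkedArray t s)

/-- The ones of the composition of `Y` with copies of `X`. -/
def composeOne (φ : Y.R → X.S) : Y.R ⊕ₗ (Y.S ×ₗ X.R) → Y.C ⊕ (Y.S × X.C) → Prop
  | Sum.inl r, Sum.inl c => Y.One r c
  | Sum.inl r, Sum.inr c => c.1 = Y.mark r ∧ c.2 = X.col (φ r)
  | Sum.inr _, Sum.inl _ => False
  | Sum.inr r, Sum.inr c => c.1 = r.1 ∧ X.One r.2 c.2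

/-- The positions of the columns of the composition: a copy of `X` is placed before every marked
column of `Y`. -/
def composePos : Y.C ⊕ (Y.S × X.C) → Y.L ×ₗ WithTop X.L
  | Sum.inl c => toLex (Y.pos c, ⊤)
  | Sum.inr c => toLex (Y.pos (Y.col c.1), (X.pos c.2 : WithTop X.L))

/-- The marked columns of the rows of the composition. -/
def composeMark (φ : Y.R → X.S) : Y.R ⊕ₗ (Y.S ×ₗ X.R) → Y.S ×ₗ X.S
  | Sum.inl r => toLex (Y.mark r, φ r)
  | Sum.inr r => toLex (r.1, X.mark r.2)

variable {X Y}

theorem composePos_injective : Function.Injective (composePos X Y) := by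
  rintro (c | ⟨s, c⟩) (d | ⟨s', d⟩) h
  · simp only [composePos, EmbeddingLike.apply_eq_iff_eq, Prod.mk.injEq, and_true] at h
    rw [Y.pos_inj h]
  · simp [composePos] at h
  · simp [composePos] at h
  · simp only [composePos, EmbeddingLike.apply_eq_iff_eq, Prod.mk.injEq, WithTop.coe_inj] at h
    rw [X.pos_inj h.2, Y.col_mono.injective h.1]

/-- A marked column of an inserted copy keeps its `m` ones from `X` and receives exactly one from
`Y`, because `φ` is a bijection from each fibre of `Y.mark` to `X.S`. -/
theorem composeMark_card_fiber {φ : Y.R → X.S}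
    (hφ : ∀ r r', Y.mark r = Y.mark r' → r < r' → φ r' < φ r)
    (hφ' : ∀ s x, ∃ r, Y.mark r = s ∧ φ r = x) (p : Y.S ×ₗ X.S) :
    Nat.card {r // composeMark X Y φ r = p} = m + 1 := by
  classical
  obtain ⟨s, x⟩ := p
  have e : {r // composeMark X Y φ r = (s, x)} ≃
      {r : Y.R // composeMark X Y φ (Sum.inl r) = (s, x)} ⊕
        {r : Y.S × X.R // composeMark X Y φ (Sum.inr r) = (s, x)} :=
    Equiv.subtypeSum (p := fun r : Y.R ⊕ (Y.S × X.R) => composeMark X Y φ r = (s, x))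
  have h₁ : Nat.card {r : Y.R // composeMark X Y φ (Sum.inl r) = (s, x)} = 1 := by
    rw [Nat.card_eq_one_iff_unique]
    obtain ⟨r, hr, hr'⟩ := hφ' s x
    refine ⟨⟨fun a b => ?_⟩, ⟨r, by simp only [composeMark, hr, hr']; rfl⟩⟩
    obtain ⟨a, ha⟩ := a
    obtain ⟨b, hb⟩ := b
    have ha₁ : Y.mark a = s := congrArg Prod.fst ha
    have ha₂ : φ a = x := congrArg Prod.snd ha
    have hb₁ : Y.mark b = s := congrArg Prod.fst hb
    have hb₂ : φ b = x := congrArg Prod.snd hb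
    rcases lt_trichotomy a b with h | h | h
    · exact absurd (hφ a b (ha₁.trans hb₁.symm) h) (by simp [ha₂, hb₂])
    · exact Subtype.ext h
    · exact absurd (hφ b a (hb₁.trans ha₁.symm) h) (by simp [ha₂, hb₂])
  have e₂ : {r : Y.S × X.R // composeMark X Y φ (Sum.inr r) = (s, x)} ≃
      {r // X.mark r = x} :=
    { toFun := fun r => ⟨r.1.2, congrArg Prod.snd r.2⟩
      invFun := fun r => ⟨(s, r.1), by
        obtain ⟨r, rfl⟩ := r; rfl⟩
      left_inv := by
        rintro ⟨⟨s', r⟩, h⟩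
        have : s' = s := congrArg Prod.fst h
        subst this; rfl
      right_inv := fun r => rfl }
  rw [Nat.card_congr e, Nat.card_sum, h₁, Nat.card_congr e₂, X.card_fiber, add_comm]

theorem composeOne_le_degree (φ : Y.R → X.S) (r : Y.R ⊕ₗ (Y.S ×ₗ X.R)) :
    t + 1 ≤ Nat.card {c // composeOne X Y φ r c} := by
  classical
  rcases r with r | ⟨s, r⟩
  · have h := Nat.card_le_card_of_injective
      (fun c : Option {c // Y.One r c} => (match c with
        | none => ⟨Sum.inr (Y.mark r, X.col (φ r)), rfl, rfl⟩
        | some c => ⟨Sum.inl c.1, c.2⟩ : {c // composeOne X Y φ (Sum.inl r) c})) (by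
        rintro (_ | c) (_ | d) h
        · rfl
        · exact absurd (congrArg Subtype.val h) Sum.inr_ne_inl
        · exact absurd (congrArg Subtype.val h) Sum.inl_ne_inr
        · exact congrArg some (Subtype.ext (Sum.inl_injective (congrArg Subtype.val h))))
    refine le_trans ?_ h
    rw [Finite.card_option]
    exact Nat.succ_le_succ (Y.le_degree r)
  · have h := Nat.card_le_card_of_injective
      (fun c : {c // X.One r c} => (⟨Sum.inr (s, c.1), rfl, c.2⟩ :
        {c // composeOne X Y φ (Sum.inr (s, r)) c})) (by
        intro c d h
        exact Subtype.ext (congrArg Prod.snd (Sum.inr_injective (congrArg Subtype.val h))))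
    exact (X.le_degree r).trans h

/-- A one of a row of `Y` in the composition comes from a one of `Y`. -/
theorem composeOne_inl {φ : Y.R → X.S} {r : Y.R} {c : Y.C ⊕ (Y.S × X.C)}
    (h : composeOne X Y φ (Sum.inl r) c) :
    ∃ d, Y.One r d ∧ ((composePos X Y c = toLex (Y.pos d, ⊤)) ∨
      d = Y.col (Y.mark r) ∧
        composePos X Y c = toLex (Y.pos d, (X.pos (X.col (φ r)) : WithTop X.L))) := by
  rcases c with c | ⟨s, c⟩
  · exact ⟨c, h, Or.inl rfl⟩
  · obtain ⟨h₁, h₂⟩ := h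
    simp only at h₁ h₂
    subst h₁ h₂
    exact ⟨_, Y.one_mark r, Or.inr ⟨rfl, rfl⟩⟩

theorem composeOne_inr {φ : Y.R → X.S} {r : Y.S × X.R} {c : Y.C ⊕ (Y.S × X.C)}
    (h : composeOne X Y φ (Sum.inr r) c) :
    ∃ d, X.One r.2 d ∧
      composePos X Y c = toLex (Y.pos (Y.col r.1), (X.pos d : WithTop X.L)) := by
  rcases c with c | ⟨s, c⟩
  · exact h.elim
  · obtain ⟨h₁, h₂⟩ := h
    simp only at h₁ h₂
    subst h₁
    exact ⟨_, h₂, rfl⟩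

/-- An alternation between two rows from the same array projects to one in `Y` or lives in a single
copy of `X`, except where both rows of `Y` are marked in the same column; there the reversal in `φ`
excludes it. A row of `Y` above a row of a copy meets the block of that copy in at most one place,
its own leftmost one. -/
theorem composeOne_free {φ : Y.R → X.S}
    (hφ : ∀ r r', Y.mark r = Y.mark r' → r < r' → φ r' < φ r)
    (a b : Y.R ⊕ₗ (Y.S ×ₗ X.R)) (hab : a < b) (a₁ b₁ a₂ b₂ : Y.C ⊕ (Y.S × X.C))
    (ha₁ : composeOne X Y φ a a₁) (hb₁ : composeOne X Y φ b b₁)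
    (ha₂ : composeOne X Y φ a a₂) (hb₂ : composeOne X Y φ b b₂)
    (h₁ : composePos X Y a₁ ≤ composePos X Y b₁) (h₂ : composePos X Y b₁ < composePos X Y a₂)
    (h₃ : composePos X Y a₂ ≤ composePos X Y b₂) : False := by
  rcases a with a | a <;> rcases b with b | b
  · have hab : a < b := Sum.Lex.inl_lt_inl_iff.1 hab
    obtain ⟨c₁, hc₁, e₁⟩ := composeOne_inl ha₁
    obtain ⟨d₁, hd₁, e₂⟩ := composeOne_inl hb₁
    obtain ⟨c₂, hc₂, e₃⟩ := composeOne_inl ha₂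
    obtain ⟨d₂, hd₂, e₄⟩ := composeOne_inl hb₂
    have l₁ : Y.pos c₁ ≤ Y.pos d₁ := by
      rcases e₁ with e₁ | ⟨-, e₁⟩ <;> rcases e₂ with e₂ | ⟨-, e₂⟩ <;>
        (rw [e₁, e₂] at h₁; exact Prod.Lex.monotone_fst _ _ h₁)
    have l₃ : Y.pos c₂ ≤ Y.pos d₂ := by
      rcases e₃ with e₃ | ⟨-, e₃⟩ <;> rcases e₄ with e₄ | ⟨-, e₄⟩ <;>
        (rw [e₃, e₄] at h₃; exact Prod.Lex.monotone_fst _ _ h₃)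
    have l₂ : Y.pos d₁ ≤ Y.pos c₂ := by
      rcases e₃ with e₃ | ⟨-, e₃⟩ <;> rcases e₂ with e₂ | ⟨-, e₂⟩ <;>
        (rw [e₂, e₃] at h₂; exact Prod.Lex.monotone_fst _ _ h₂.le)
    rcases l₂.lt_or_eq with l₂ | l₂
    · exact Y.free a b hab c₁ d₁ c₂ d₂ hc₁ hd₁ hc₂ hd₂ l₁ l₂ l₃
    -- `b₁` strictly precedes `a₂` over the same column of `Y`, so `b₁` lies in the inserted copy.
    -- That column is then marked for both rows, which forces `a₁` into the copy too, against the
    -- reversed order of `φ`.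
    · have hd : d₁ = c₂ := Y.pos_inj l₂
      subst hd
      rcases e₂ with e₂ | ⟨e₂', e₂⟩
      · rcases e₃ with e₃ | ⟨-, e₃⟩ <;> (rw [e₂, e₃] at h₂; simp [Prod.Lex.toLex_lt_toLex] at h₂)
      · subst e₂'
        have hm := Y.mark_unique a _ hc₂
        have l₄ := Y.leftmost a c₁ hc₁
        rw [← hm] at l₄
        have hc : c₁ = Y.col (Y.mark b) := Y.pos_inj (le_antisymm l₁ l₄)
        subst hc
        rcases e₁ with e₁ | ⟨-, e₁⟩
        · rw [e₁, e₂] at h₁; simp [Prod.Lex.toLex_le_toLex] at h₁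
        · rw [e₁, e₂] at h₁
          simp only [Prod.Lex.toLex_le_toLex, lt_self_iff_false, true_and, false_or,
            WithTop.coe_le_coe] at h₁
          exact absurd (X.col_mono (hφ a b hm.symm hab)) (not_lt.2 h₁)
  · obtain ⟨c₁, hc₁, e₁⟩ := composeOne_inl ha₁
    obtain ⟨d₁, hd₁, e₂⟩ := composeOne_inr hb₁
    obtain ⟨c₂, hc₂, e₃⟩ := composeOne_inl ha₂
    obtain ⟨d₂, hd₂, e₄⟩ := composeOne_inr hb₂
    have l₂ : Y.pos (Y.col b.1) ≤ Y.pos c₂ := by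
      rcases e₃ with e₃ | ⟨-, e₃⟩ <;>
        (rw [e₂, e₃] at h₂; exact Prod.Lex.monotone_fst _ _ h₂.le)
    rcases e₃ with e₃ | ⟨e₃', e₃⟩
    · rw [e₃, e₄] at h₃
      simp only [Prod.Lex.toLex_le_toLex, top_le_iff, WithTop.coe_ne_top, and_false,
        or_false] at h₃
      exact absurd h₃ (not_lt.2 l₂)
    -- `a₂` is the copied one of `a`, its leftmost one in the composition, so no `b₁` fits strictly
    -- between `a₁` and `a₂`.
    · have l₄ : Y.pos c₂ ≤ Y.pos c₁ := e₃' ▸ Y.leftmost a c₁ hc₁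
      rcases e₁ with e₁ | ⟨e₁', e₁⟩
      · rw [e₁, e₂] at h₁
        simp only [Prod.Lex.toLex_le_toLex, top_le_iff, WithTop.coe_ne_top, and_false,
          or_false] at h₁
        exact absurd h₁ (not_lt.2 (l₂.trans l₄))
      · rw [e₃, e₃', ← e₁', ← e₁] at h₂
        exact absurd h₂ (not_lt.2 h₁)
  · exact absurd hab Sum.Lex.not_inr_lt_inl
  · obtain ⟨c₁, hc₁, e₁⟩ := composeOne_inr ha₁
    obtain ⟨d₁, hd₁, e₂⟩ := composeOne_inr hb₁
    obtain ⟨c₂, hc₂, e₃⟩ := composeOne_inr ha₂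
    obtain ⟨d₂, hd₂, e₄⟩ := composeOne_inr hb₂
    have hab := Sum.Lex.inr_lt_inr_iff.1 hab
    obtain ⟨s, a⟩ := a
    obtain ⟨s', b⟩ := b
    rw [e₁, e₂] at h₁
    rw [e₂, e₃] at h₂
    rw [e₃, e₄] at h₃
    have l₁ : Y.pos (Y.col s) ≤ Y.pos (Y.col s') := Prod.Lex.monotone_fst _ _ h₁
    have l₂ : Y.pos (Y.col s') ≤ Y.pos (Y.col s) := Prod.Lex.monotone_fst _ _ h₂.le
    have hs : s = s' := Y.col_mono.injective (le_antisymm l₁ l₂)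
    subst hs
    have hab : a < b := by
      have := (Prod.Lex.toLex_lt_toLex (x := (s, a)) (y := (s, b))).1 hab
      simpa using this
    simp only [Prod.Lex.toLex_le_toLex, Prod.Lex.toLex_lt_toLex, lt_self_iff_false, true_and,
      false_or, WithTop.coe_le_coe, WithTop.coe_lt_coe] at h₁ h₂ h₃
    exact X.free a b hab c₁ d₁ c₂ d₂ hc₁ hd₁ hc₂ hd₂ h₁ h₂ h₃

variable (X Y)

/-- The composition of `Y` with copies of `X`, one for every marked column of `Y`: the ones of a
marked column of `Y` are kept, and copied in reverse order to the marked columns of the copy of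
`X`. -/
def compose (φ : Y.R → X.S) (hφ : ∀ r r', Y.mark r = Y.mark r' → r < r' → φ r' < φ r)
    (hφ' : ∀ s x, ∃ r, Y.mark r = s ∧ φ r = x) : MarkedArray (t + 1) (m + 1) where
  R := Y.R ⊕ₗ (Y.S ×ₗ X.R)
  S := Y.S ×ₗ X.S
  C := Y.C ⊕ (Y.S × X.C)
  L := Y.L ×ₗ WithTop X.L
  finR := inferInstanceAs (Fintype (Y.R ⊕ (Y.S × X.R)))
  finS := inferInstanceAs (Fintype (Y.S × X.S))
  pos := composePos X Y
  pos_inj := composePos_injective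
  col := fun p => Sum.inr ((ofLex p).1, X.col (ofLex p).2)
  col_mono := by
    rintro ⟨s, x⟩ ⟨s', x'⟩ h
    have h := (Prod.Lex.toLex_lt_toLex (x := (s, x)) (y := (s', x'))).1 h
    refine Prod.Lex.toLex_lt_toLex.2 ?_
    rcases h with h | ⟨h, h'⟩
    · exact Or.inl (Y.col_mono h)
    · refine Or.inr ⟨congrArg (fun s => Y.pos (Y.col s)) h, ?_⟩
      exact WithTop.coe_lt_coe.2 (X.col_mono h')
  mark := composeMark X Y φ
  One := composeOne X Y φ
  one_mark := by
    rintro (r | ⟨s, r⟩)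
    · exact ⟨rfl, rfl⟩
    · exact ⟨rfl, X.one_mark r⟩
  leftmost := by
    rintro (r | ⟨s, r⟩) (c | ⟨s', c⟩) h
    · refine Prod.Lex.toLex_le_toLex.2 ?_
      rcases (Y.leftmost r c h).lt_or_eq with h | h
      · exact Or.inl h
      · exact Or.inr ⟨h, le_top⟩
    · obtain ⟨h₁, h₂⟩ := h
      simp only at h₁ h₂
      subst h₁ h₂
      exact le_rfl
    · exact h.elim
    · obtain ⟨h₁, h₂⟩ := h
      simp only at h₁ h₂
      subst h₁
      exact Prod.Lex.toLex_le_toLex.2 (Or.inr ⟨rfl, WithTop.coe_le_coe.2 (X.leftmost r c h₂)⟩)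
  mark_unique := by
    rintro (r | ⟨s, r⟩) ⟨s', x⟩ h
    · obtain ⟨h₁, h₂⟩ := h
      have h₁ : s' = Y.mark r := h₁
      have h₃ : x = φ r := X.col_mono.injective (congrArg X.pos h₂)
      rw [h₁, h₃]
      rfl
    · obtain ⟨h₁, h₂⟩ := h
      have h₁ : s' = s := h₁
      have h₃ : x = X.mark r := X.mark_unique r _ h₂
      rw [h₁, h₃]
      rfl
  card_fiber := composeMark_card_fiber hφ hφ'
  le_degree := composeOne_le_degree φ
  free := composeOne_free hφ

end Compose

/-! ### Counting rows and columns -/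

theorem exists_compose {t m : ℕ} (X : MarkedArray (t + 1) m)
    (Y : MarkedArray t (Fintype.card X.S)) :
    ∃ Z : MarkedArray (t + 1) (m + 1),
      Fintype.card Z.S = Fintype.card Y.S * Fintype.card X.S ∧
      Fintype.card Z.R = Fintype.card Y.R + Fintype.card Y.S * Fintype.card X.R ∧
      Fintype.card Z.C = Fintype.card Y.C + Fintype.card Y.S * Fintype.card X.C := by
  obtain ⟨φ, hφ, hφ'⟩ := Y.exists_reverse_matching X.S rfl
  refine ⟨compose X Y φ hφ hφ', ?_, ?_, ?_⟩
  · exact Fintype.card_prod Y.S X.S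
  · exact (Fintype.card_sum (α := Y.R) (β := Y.S × X.R)).trans (by rw [Fintype.card_prod])
  · exact (Fintype.card_sum (α := Y.C) (β := Y.S × X.C)).trans (by rw [Fintype.card_prod])

/-- There are marked arrays with many ones in every row and far fewer columns than rows. -/
theorem exists_card_columns_le (t q : ℕ) : ∃ A, ∀ m, A ≤ m →
    ∃ X : MarkedArray t m, q * Fintype.card X.C ≤ Fintype.card X.R ∧ 0 < Fintype.card X.S := by
  induction t generalizing q with
  | zero =>
    refine ⟨q, fun m hm => ⟨singleColumn m, ?_, ?_⟩⟩
    · change q * Fintype.card Unit ≤ Fintype.card (Fin m)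
      simpa using hm
    · change 0 < Fintype.card Unit
      simp
  | succ t ih =>
    -- The factor 2 leaves room for the error term in `key`, which will be at most `Fintype.card
    -- X.R`.
    obtain ⟨A, hA⟩ := ih (2 * q)
    -- The inequality is additive under composition: `Y` contributes no error, and the error of the
    -- copies of `X` scales with their number, as does the number of marked columns. The bound `A +
    -- 1` lets `hA` supply the next `Y`.
    have key : ∀ m, ∃ X : MarkedArray (t + 1) (m + 1), A + 1 ≤ Fintype.card X.S ∧
        2 * q * Fintype.card X.C ≤ Fintype.card X.R + 2 * q * (t + 1) * Fintype.card X.S := by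
      intro m
      induction m with
      | zero =>
        refine ⟨disjointRows t (A + 1), ?_, ?_⟩
        · change A + 1 ≤ Fintype.card (Fin (A + 1))
          simp
        · change 2 * q * Fintype.card (Fin (A + 1) × Fin (t + 1)) ≤
            Fintype.card (Fin (A + 1)) + 2 * q * (t + 1) * Fintype.card (Fin (A + 1))
          simp only [Fintype.card_prod, Fintype.card_fin]
          nlinarith
      | succ m ihm =>
        obtain ⟨X, hX, hX'⟩ := ihm
        obtain ⟨Y, hY, hY'⟩ := hA (Fintype.card X.S) (by omega)
        obtain ⟨Z, hS, hR, hC⟩ := exists_compose X Y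
        refine ⟨Z, ?_, ?_⟩
        · rw [hS]
          exact hX.trans (Nat.le_mul_of_pos_left _ hY')
        · rw [hS, hR, hC]
          have := Nat.mul_le_mul_left (Fintype.card Y.S) hX'
          nlinarith
    -- As there are `m` rows per marked column, `m ≥ 2q(t+1)` makes the error at most the number of
    -- rows.
    refine ⟨2 * q * (t + 1) + 1, fun m hm => ?_⟩
    obtain ⟨m, rfl⟩ : ∃ m', m = m' + 1 := ⟨m - 1, by omega⟩
    obtain ⟨X, hX, hX'⟩ := key m
    refine ⟨X, ?_, by omega⟩
    have h₁ := X.card_rows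
    have h₂ : 2 * q * (t + 1) * Fintype.card X.S ≤ (m + 1) * Fintype.card X.S :=
      Nat.mul_le_mul_right _ (by omega)
    rw [← h₁] at h₂
    have h₃ : 2 * q * Fintype.card X.C = 2 * (q * Fintype.card X.C) := by ring
    omega

end MarkedArray

end ZeroOneMatrix

/-! ### Elementary bounds on the extremal function -/

namespace ZeroOneMatrix

theorem ones_eq_sum {k l : ℕ} (M : ZeroOneMatrix k l) :
    M.ones = ∑ i, (Finset.univ.filter fun j => M i j = true).card := by
  classical
  simp only [ones, Finset.card_filter]
  rw [Fintype.sum_prod_type]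

theorem ones_le {k l : ℕ} (M : ZeroOneMatrix k l) : M.ones ≤ k * l := by
  refine (Finset.card_filter_le _ _).trans ?_
  simp

theorem ones_le_ex {k l n : ℕ} {P : ZeroOneMatrix k l} {M : ZeroOneMatrix n n}
    (h : M.Avoids P) : M.ones ≤ ex n P := by
  refine le_csSup ⟨n * n, ?_⟩ ⟨M, h, rfl⟩
  rintro _ ⟨M, -, rfl⟩
  exact ones_le M

theorem ex_le {k l n B : ℕ} {P : ZeroOneMatrix k l}
    (h : ∀ M : ZeroOneMatrix n n, M.Avoids P → M.ones ≤ B) : ex n P ≤ B := by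
  refine csSup_le' ?_
  rintro _ ⟨M, hM, rfl⟩
  exact h M hM

theorem isLinear_of_ex_le {k l C : ℕ} {P : ZeroOneMatrix k l} (h : ∀ n, ex n P ≤ C * n) :
    P.IsLinear := by
  refine IsBigO.of_bound C (Eventually.of_forall fun n => ?_)
  rw [Real.norm_natCast, Real.norm_natCast]
  exact_mod_cast h n

theorem IsLinear.exists_ex_le {k l : ℕ} {P : ZeroOneMatrix k l} (h : P.IsLinear) :
    ∃ C, ∀ n, ex n P ≤ C * n := by
  obtain ⟨c, hc⟩ := h.bound
  obtain ⟨N, hN⟩ := eventually_atTop.1 hc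
  refine ⟨⌈c⌉₊ + N, fun n => ?_⟩
  rcases le_or_gt N n with hn | hn
  · have h₁ := hN n hn
    rw [Real.norm_natCast, Real.norm_natCast] at h₁
    have h₂ : (ex n P : ℝ) ≤ ⌈c⌉₊ * n :=
      h₁.trans (mul_le_mul_of_nonneg_right (Nat.le_ceil c) (Nat.cast_nonneg n))
    have h₃ : ex n P ≤ ⌈c⌉₊ * n := by exact_mod_cast h₂
    exact h₃.trans (Nat.mul_le_mul_right _ (Nat.le_add_right _ _))
  · exact (ex_le fun M _ => ones_le M).trans (Nat.mul_le_mul_right _ (by omega))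

theorem IsLinear.not_isSuperlinear {k l : ℕ} {P : ZeroOneMatrix k l} (h : P.IsLinear) :
    ¬ P.IsSuperlinear := by
  intro h'
  have h₁ : (fun n : ℕ => (n : ℝ)) =o[atTop] (fun n : ℕ => (n : ℝ)) := h'.trans_isBigO h
  refine isLittleO_irrefl' (Eventually.frequently ?_) h₁
  filter_upwards [eventually_gt_atTop 0] with n hn
  simpa using hn.ne'

theorem isLinear_of_rows_le_one {k l : ℕ} (hk : k ≤ 1) (P : ZeroOneMatrix k l) : P.IsLinear := by
  classical
  refine isLinear_of_ex_le (C := l) fun n => ex_le fun M hM => ?_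
  have hrow : ∀ r, (Finset.univ.filter fun j => M r j = true).card ≤ l := by
    intro r
    by_contra! hr
    refine hM ⟨OrderEmbedding.ofStrictMono (fun _ => r) fun i j hij => ?_,
      Finset.orderEmbOfCardLe _ hr.le, fun i j _ => ?_⟩
    · exact absurd hij (by omega)
    · exact (Finset.mem_filter.1 (Finset.orderEmbOfCardLe_mem _ hr.le j)).2
  rw [ones_eq_sum]
  refine (Finset.sum_le_card_nsmul _ _ l fun r _ => hrow r).trans ?_
  simp [mul_comm]

/-! ### Alternating rows are non-linear -/

/-- Square matrices with many ones in which no two rows `a < b` have ones in columns `a₁, a₂` and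
`b₁, b₂` with `a₁ ≤ b₁ < a₂ ≤ b₂`. -/
theorem exists_crossing_free (t : ℕ) : ∃ (n : ℕ) (M : ZeroOneMatrix n n), 0 < n ∧ t * n ≤ M.ones ∧
    ∀ a b, a < b → ∀ a₁ b₁ a₂ b₂, M a a₁ = true → M b b₁ = true → M a a₂ = true →
      M b b₂ = true → a₁ ≤ b₁ → b₁ < a₂ → a₂ ≤ b₂ → False := by
  classical
  obtain ⟨A, hA⟩ := MarkedArray.exists_card_columns_le t 1
  obtain ⟨X, hC, hS⟩ := hA (A + 1) (Nat.le_succ A)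
  rw [one_mul] at hC
  have hR : 0 < Fintype.card X.R := by
    rw [X.card_rows]; exact Nat.mul_pos (Nat.succ_pos A) hS
  let : LinearOrder X.C := LinearOrder.lift' X.pos X.pos_inj
  let e := Fintype.orderIsoFinOfCardEq X.R rfl
  -- Empty columns pad the array to a square.
  let c : X.C ↪o Fin (Fintype.card X.R) :=
    (Fintype.orderIsoFinOfCardEq X.C rfl).symm.toOrderEmbedding.trans (Fin.castLEOrderEmb hC)
  obtain ⟨M, hM⟩ : ∃ M : ZeroOneMatrix (Fintype.card X.R) (Fintype.card X.R),
      ∀ i j, M i j = true ↔ ∃ x, c x = j ∧ X.One (e i) x :=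
    ⟨fun i j => decide (∃ x, c x = j ∧ X.One (e i) x), fun i j => decide_eq_true_iff⟩
  refine ⟨Fintype.card X.R, M, hR, ?_, ?_⟩
  · rw [ones_eq_sum, mul_comm]
    refine le_trans ?_ (Finset.card_nsmul_le_sum _ _ t fun i _ => ?_)
    · simp
    · refine (X.le_degree (e i)).trans ?_
      rw [Nat.card_eq_fintype_card, Fintype.card_subtype, ← Finset.card_map c.toEmbedding]
      refine Finset.card_le_card fun j hj => ?_
      simp only [Finset.mem_map, Finset.mem_filter, Finset.mem_univ, true_and] at hj
      obtain ⟨x, hx, rfl⟩ := hj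
      exact Finset.mem_filter.2 ⟨Finset.mem_univ _, (hM _ _).2 ⟨x, rfl, hx⟩⟩
  · intro a b hab a₁ b₁ a₂ b₂ ha₁ hb₁ ha₂ hb₂ h₁ h₂ h₃
    obtain ⟨x₁, rfl, hx₁⟩ := (hM _ _).1 ha₁
    obtain ⟨y₁, rfl, hy₁⟩ := (hM _ _).1 hb₁
    obtain ⟨x₂, rfl, hx₂⟩ := (hM _ _).1 ha₂
    obtain ⟨y₂, rfl, hy₂⟩ := (hM _ _).1 hb₂
    exact X.free _ _ (e.strictMono hab) x₁ y₁ x₂ y₂ hx₁ hy₁ hx₂ hy₂ (c.le_iff_le.1 h₁)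
      (c.lt_iff_lt.1 h₂) (c.le_iff_le.1 h₃)

/-- A matrix with a (possibly degenerate) alternation of two of its rows is not linear. -/
theorem not_isLinear_of_crossing {k l : ℕ} {P : ZeroOneMatrix k l} {a b : Fin k} (hab : a ≠ b)
    {a₁ b₁ a₂ b₂ : Fin l} (ha₁ : P a a₁ = true) (hb₁ : P b b₁ = true) (ha₂ : P a a₂ = true)
    (hb₂ : P b b₂ = true) (h₁ : a₁ ≤ b₁) (h₂ : b₁ < a₂) (h₃ : a₂ ≤ b₂) : ¬ P.IsLinear := by
  classical
  intro hP
  obtain ⟨C, hC⟩ := hP.exists_ex_le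
  obtain ⟨n, M, hn, hM, hfree⟩ := exists_crossing_free (C + 1)
  have hlt : C * n < (C + 1) * n := Nat.mul_lt_mul_of_pos_right (Nat.lt_succ_self C) hn
  rcases lt_or_gt_of_ne hab with hab | hab
  · have hav : M.Avoids P := by
      rintro ⟨f, g, h⟩
      exact hfree (f a) (f b) (f.strictMono hab) _ _ _ _ (h _ _ ha₁) (h _ _ hb₁) (h _ _ ha₂)
        (h _ _ hb₂) (g.monotone h₁) (g.strictMono h₂) (g.monotone h₃)
    exact absurd ((hM.trans (ones_le_ex hav)).trans (hC n)) (not_le.2 hlt)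
  -- Turning the matrix upside down handles the opposite order of the two rows.
  · let M' : ZeroOneMatrix n n := fun i j => M i.rev j
    have hav : M'.Avoids P := by
      rintro ⟨f, g, h⟩
      exact hfree (f a).rev (f b).rev (Fin.rev_lt_rev.2 (f.strictMono hab)) _ _ _ _ (h _ _ ha₁)
        (h _ _ hb₁) (h _ _ ha₂) (h _ _ hb₂) (g.monotone h₁) (g.strictMono h₂) (g.monotone h₃)
    have hones : M'.ones = M.ones := by
      rw [ones_eq_sum, ones_eq_sum]
      exact Fintype.sum_equiv Fin.revPerm _ _ fun i => rfl
    exact absurd ((hM.trans (hones ▸ ones_le_ex hav)).trans (hC n)) (not_le.2 hlt)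

/-! ### Sparsening and the deletion of a one -/

/-- Any finite set of size about `(l + 1) * N` has a subset of size about `N` all of whose gaps
contain `l` elements of the set. -/
theorem exists_sparse_subset (l : ℕ) {α : Type*} [LinearOrder α] (T : Finset α) :
    ∃ K ⊆ T, T.card ≤ (l + 1) * (K.card + 2) ∧
      (∀ x ∈ K, ∃ h : Fin l → α, StrictMono h ∧ ∀ i, h i ∈ T ∧ h i < x) ∧
      (∀ x ∈ K, ∃ h : Fin l → α, StrictMono h ∧ ∀ i, h i ∈ T ∧ x < h i) ∧
      ∀ x ∈ K, ∀ y ∈ K, x < y →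
        ∃ h : Fin l → α, StrictMono h ∧ ∀ i, h i ∈ T ∧ x < h i ∧ h i < y := by
  classical
  let e := T.orderEmbOfFin rfl
  have bound : ∀ j : Fin (T.card / (l + 1) - 1), (l + 1) * j + l + (l + 1) < T.card + 1 := by
    intro j
    have h₁ : (l + 1) * (T.card / (l + 1)) ≤ T.card := Nat.mul_div_le _ _
    have h₂ : (l + 1) * (j + 2) ≤ (l + 1) * (T.card / (l + 1)) :=
      Nat.mul_le_mul_left _ (by omega)
    have h₃ : (l + 1) * ((j : ℕ) + 2) = (l + 1) * j + l + (l + 1) + 1 := by ring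
    omega
  -- The last element of each full block of `l + 1` is kept, except for the last full block, which
  -- provides the elements to the right.
  let k : Fin (T.card / (l + 1) - 1) → α := fun j => e ⟨(l + 1) * j + l, by have := bound j; omega⟩
  have hk : StrictMono k := fun i j hij => by
    refine e.strictMono (Fin.mk_lt_mk.2 ?_)
    have := Nat.mul_lt_mul_of_pos_left (Fin.lt_def.1 hij) (Nat.succ_pos l)
    simp only [Nat.succ_eq_add_one] at this
    omega
  refine ⟨Finset.univ.image k, ?_, ?_, ?_, ?_, ?_⟩
  · intro x hx
    obtain ⟨j, -, rfl⟩ := Finset.mem_image.1 hx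
    exact Finset.orderEmbOfFin_mem _ _ _
  · rw [Finset.card_image_of_injective _ hk.injective, Finset.card_univ, Fintype.card_fin]
    have h₁ := Nat.lt_mul_div_succ T.card (Nat.succ_pos l)
    simp only [Nat.succ_eq_add_one] at h₁
    refine h₁.le.trans (Nat.mul_le_mul_left _ (by omega))
  · intro x hx
    obtain ⟨j, -, rfl⟩ := Finset.mem_image.1 hx
    have hj := bound j
    refine ⟨fun i => e ⟨(l + 1) * j + i, by omega⟩, fun i i' h => ?_, fun i => ⟨?_, ?_⟩⟩
    · exact e.strictMono (Fin.mk_lt_mk.2 (by omega))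
    · exact Finset.orderEmbOfFin_mem _ _ _
    · exact e.strictMono (Fin.mk_lt_mk.2 (by omega))
  · intro x hx
    obtain ⟨j, -, rfl⟩ := Finset.mem_image.1 hx
    have hj := bound j
    refine ⟨fun i => e ⟨(l + 1) * j + l + 1 + i, by omega⟩, fun i i' h => ?_, fun i => ⟨?_, ?_⟩⟩
    · exact e.strictMono (Fin.mk_lt_mk.2 (by omega))
    · exact Finset.orderEmbOfFin_mem _ _ _
    · exact e.strictMono (Fin.mk_lt_mk.2 (by omega))
  · intro x hx y hy hxy
    obtain ⟨j, -, rfl⟩ := Finset.mem_image.1 hx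
    obtain ⟨j', -, rfl⟩ := Finset.mem_image.1 hy
    have hj := bound j
    have hjj : (j : ℕ) + 1 ≤ j' := hk.lt_iff_lt.1 hxy
    have hjj := Nat.mul_le_mul_left (l + 1) hjj
    rw [mul_add] at hjj
    refine ⟨fun i => e ⟨(l + 1) * j + l + 1 + i, by omega⟩, fun i i' h => ?_,
      fun i => ⟨?_, ?_, ?_⟩⟩
    · exact e.strictMono (Fin.mk_lt_mk.2 (by omega))
    · exact Finset.orderEmbOfFin_mem _ _ _
    · exact e.strictMono (Fin.mk_lt_mk.2 (by omega))
    · exact e.strictMono (Fin.mk_lt_mk.2 (by omega))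

/-- `M'` arises from `M` by deleting ones, and any one left in `M'` has `l` ones of `M` in its row
between itself and any other one of `M'` in this row, and also on either side. -/
structure IsSparsening (l : ℕ) {n : ℕ} (M M' : ZeroOneMatrix n n) : Prop where
  le : ∀ i j, M' i j = true → M i j = true
  left : ∀ i y, M' i y = true → ∃ h : Fin l → Fin n, StrictMono h ∧
    ∀ j, M i (h j) = true ∧ h j < y
  right : ∀ i x, M' i x = true → ∃ h : Fin l → Fin n, StrictMono h ∧
    ∀ j, M i (h j) = true ∧ x < h j
  between : ∀ i x y, M' i x = true → M' i y = true → x < y → ∃ h : Fin l → Fin n,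
    StrictMono h ∧ ∀ j, M i (h j) = true ∧ x < h j ∧ h j < y

theorem exists_isSparsening (l : ℕ) {n : ℕ} (M : ZeroOneMatrix n n) :
    ∃ M', IsSparsening l M M' ∧ M.ones ≤ (l + 1) * (M'.ones + 2 * n) := by
  classical
  choose K hK hcard hl hr hb using fun i =>
    exists_sparse_subset l (Finset.univ.filter fun j => M i j = true)
  simp only [Finset.mem_filter, Finset.mem_univ, true_and] at hl hr hb
  obtain ⟨M', hM'⟩ : ∃ M' : ZeroOneMatrix n n, ∀ i j, M' i j = true ↔ j ∈ K i :=
    ⟨fun i j => decide (j ∈ K i), fun i j => decide_eq_true_iff⟩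
  refine ⟨M', ⟨?_, ?_, ?_, ?_⟩, ?_⟩
  · exact fun i j h => (Finset.mem_filter.1 (hK i ((hM' i j).1 h))).2
  · exact fun i y h => hl i y ((hM' i y).1 h)
  · exact fun i y h => hr i y ((hM' i y).1 h)
  · exact fun i x y h h' => hb i x ((hM' i x).1 h) y ((hM' i y).1 h')
  · rw [ones_eq_sum, ones_eq_sum]
    refine (Finset.sum_le_sum fun i _ => hcard i).trans ?_
    rw [← Finset.mul_sum, Finset.sum_add_distrib]
    simp [hM', mul_comm]

/-- If the columns in `J` have ones in a single row only, a copy of the rest of `P` extends to a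
copy of `P` once this row provides enough ones in the right place. -/
theorem contains_of_patch {n k l : ℕ} {M : ZeroOneMatrix n n} {P : ZeroOneMatrix k l} {a : Fin k}
    {J : Set (Fin l)} (hJ : ∀ i, ∀ j ∈ J, P i j = true → i = a) (f : Fin k ↪o Fin n)
    (g : Fin l ↪o Fin n) (hfg : ∀ i, ∀ j ∉ J, P i j = true → M (f i) (g j) = true)
    {h : Fin l → Fin n} (hmono : StrictMono h) (hh : ∀ j, M (f a) (h j) = true)
    (hlt : ∀ j ∉ J, ∀ j' ∈ J, j < j' → g j < h j')
    (hgt : ∀ j ∉ J, ∀ j' ∈ J, j' < j → h j' < g j) : M.Contains P := by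
  classical
  refine ⟨f, OrderEmbedding.ofStrictMono (fun j => if j ∈ J then h j else g j) ?_, ?_⟩
  · intro j j' hjj
    by_cases h₁ : j ∈ J <;> by_cases h₂ : j' ∈ J <;> simp only [h₁, h₂, if_true, if_false]
    · exact hmono hjj
    · exact hgt _ h₂ _ h₁ hjj
    · exact hlt _ h₁ _ h₂ hjj
    · exact g.strictMono hjj
  · intro i j hij
    change M (f i) (if j ∈ J then h j else g j) = true
    by_cases h₁ : j ∈ J
    · rw [if_pos h₁, hJ i j h₁ hij]
      exact hh j
    · rw [if_neg h₁]
      exact hfg i j h₁ hij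

/-- `P` with the entry in row `a` and column `c` replaced by a zero. -/
def erase {k l : ℕ} (P : ZeroOneMatrix k l) (a : Fin k) (c : Fin l) : ZeroOneMatrix k l :=
  fun i j => P i j && !(decide (i = a) && decide (j = c))

theorem erase_apply {k l : ℕ} {P : ZeroOneMatrix k l} {a i : Fin k} {c j : Fin l}
    (h : P i j = true) (hj : j ≠ c) : P.erase a c i j = true := by
  simp [erase, h, hj]

/-- Sparsening costs only the factor `l + 1` and a linear term, so a linear bound for `Q` on the
sparse matrix becomes one for `P`. -/
theorem isLinear_of_contains_sparsening {k l : ℕ} {P Q : ZeroOneMatrix k l} (hQ : Q.IsLinear)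
    (h : ∀ (n : ℕ) (M M' : ZeroOneMatrix n n), IsSparsening l M M' → M'.Contains Q →
      M.Contains P) : P.IsLinear := by
  obtain ⟨C, hC⟩ := hQ.exists_ex_le
  refine isLinear_of_ex_le (C := (l + 1) * (C + 2)) fun n => ex_le fun M hM => ?_
  obtain ⟨M', hM', hcard⟩ := exists_isSparsening l M
  have h₁ : M'.ones ≤ C * n := (ones_le_ex fun hc => hM (h n M M' hM' hc)).trans (hC n)
  calc M.ones ≤ (l + 1) * (M'.ones + 2 * n) := hcard
    _ ≤ (l + 1) * (C * n + 2 * n) := Nat.mul_le_mul_left _ (by omega)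
    _ = (l + 1) * (C + 2) * n := by ring

/-- The ones at `c₁` and `c₃` survive the erasure, so their images in the sparse matrix enclose `l`
ones of row `f a`, enough to rebuild all columns strictly between. -/
theorem isLinear_of_erase_between {k l : ℕ} {P : ZeroOneMatrix k l} {a : Fin k}
    {c₁ c₂ c₃ : Fin l} (h₁₂ : c₁ < c₂) (h₂₃ : c₂ < c₃) (h₁ : P a c₁ = true) (h₃ : P a c₃ = true)
    (hJ : ∀ i j, c₁ < j → j < c₃ → P i j = true → i = a) (hP : (P.erase a c₂).IsLinear) :
    P.IsLinear := by
  refine isLinear_of_contains_sparsening hP ?_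
  rintro n M M' hM ⟨f, g, hfg⟩
  obtain ⟨h, hmono, hh⟩ := hM.between (f a) (g c₁) (g c₃) (hfg _ _ (erase_apply h₁ h₁₂.ne))
    (hfg _ _ (erase_apply h₃ h₂₃.ne')) (g.strictMono (h₁₂.trans h₂₃))
  refine contains_of_patch (a := a) (J := Set.Ioo c₁ c₃) (fun i j hj hij => hJ i j hj.1 hj.2 hij)
    f g (fun i j hj hij => hM.le _ _ (hfg _ _ (erase_apply hij ?_))) hmono (fun j => (hh j).1)
    (fun j hj j' hj' hjj => ?_) (fun j hj j' hj' hjj => ?_)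
  · rintro rfl; exact hj ⟨h₁₂, h₂₃⟩
  · refine lt_of_le_of_lt (g.monotone ?_) (hh j').2.1
    by_contra! hc; exact hj ⟨hc, hjj.trans hj'.2⟩
  · refine lt_of_lt_of_le (hh j').2.2 (g.monotone ?_)
    by_contra! hc; exact hj ⟨hj'.1.trans hjj, hc⟩

theorem isLinear_of_erase_first {k l : ℕ} {P : ZeroOneMatrix k l} {a : Fin k} {c₀ c₁ : Fin l}
    (h₀₁ : c₀ < c₁) (h₁ : P a c₁ = true) (hJ : ∀ i j, j < c₁ → P i j = true → i = a)
    (hP : (P.erase a c₀).IsLinear) : P.IsLinear := by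
  refine isLinear_of_contains_sparsening hP ?_
  rintro n M M' hM ⟨f, g, hfg⟩
  obtain ⟨h, hmono, hh⟩ := hM.left (f a) (g c₁) (hfg _ _ (erase_apply h₁ h₀₁.ne'))
  refine contains_of_patch (a := a) (J := Set.Iio c₁) (fun i j hj hij => hJ i j hj hij)
    f g (fun i j hj hij => hM.le _ _ (hfg _ _ (erase_apply hij ?_))) hmono (fun j => (hh j).1)
    (fun j hj j' hj' hjj => ?_) (fun j hj j' hj' hjj => ?_)
  · rintro rfl; exact hj h₀₁
  · exact absurd (hjj.trans hj') hj
  · exact lt_of_lt_of_le (hh j').2 (g.monotone (not_lt.1 hj))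

theorem isLinear_of_erase_last {k l : ℕ} {P : ZeroOneMatrix k l} {a : Fin k} {c₀ c₁ : Fin l}
    (h₀₁ : c₁ < c₀) (h₁ : P a c₁ = true) (hJ : ∀ i j, c₁ < j → P i j = true → i = a)
    (hP : (P.erase a c₀).IsLinear) : P.IsLinear := by
  refine isLinear_of_contains_sparsening hP ?_
  rintro n M M' hM ⟨f, g, hfg⟩
  obtain ⟨h, hmono, hh⟩ := hM.right (f a) (g c₁) (hfg _ _ (erase_apply h₁ h₀₁.ne))
  refine contains_of_patch (a := a) (J := Set.Ioi c₁) (fun i j hj hij => hJ i j hj hij)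
    f g (fun i j hj hij => hM.le _ _ (hfg _ _ (erase_apply hij ?_))) hmono (fun j => (hh j).1)
    (fun j hj j' hj' hjj => ?_) (fun j hj j' hj' hjj => ?_)
  · rintro rfl; exact hj h₀₁
  · exact lt_of_le_of_lt (g.monotone (not_lt.1 hj)) (hh j').2
  · exact absurd (lt_trans hj' hjj) hj

/-! ### Consequences of minimality -/

theorem IsMinimallyNonlinear.isLinear_of_le {k l : ℕ} {P Q : ZeroOneMatrix k l}
    (hP : P.IsMinimallyNonlinear) (hQ : ∀ i j, Q i j = true → P i j = true) (hne : Q ≠ P) :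
    Q.IsLinear := by
  refine hP.2 k l Q ⟨RelEmbedding.refl _, RelEmbedding.refl _, hQ⟩ fun h => hne ?_
  simpa using h

theorem IsMinimallyNonlinear.isLinear_erase {k l : ℕ} {P : ZeroOneMatrix k l}
    (hP : P.IsMinimallyNonlinear) {a : Fin k} {c : Fin l} (h : P a c = true) :
    (P.erase a c).IsLinear := by
  refine hP.isLinear_of_le (fun i j hij => ?_) fun he => ?_
  · simp only [erase, Bool.and_eq_true] at hij
    exact hij.1
  · have := congrFun (congrFun he a) c
    simp [erase, h] at this

theorem IsMinimallyNonlinear.not_crossing {k l : ℕ} {P : ZeroOneMatrix k l}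
    (hP : P.IsMinimallyNonlinear) (hcard : 4 < P.ones) {a b : Fin k} (hab : a ≠ b)
    {a₁ b₁ a₂ b₂ : Fin l} (ha₁ : P a a₁ = true) (hb₁ : P b b₁ = true) (ha₂ : P a a₂ = true)
    (hb₂ : P b b₂ = true) (h₁ : a₁ ≤ b₁) (h₂ : b₁ < a₂) (h₃ : a₂ ≤ b₂) : False := by
  classical
  let T : Finset (Fin k × Fin l) := {(a, a₁), (b, b₁), (a, a₂), (b, b₂)}
  let Q : ZeroOneMatrix k l := fun i j => decide ((i, j) ∈ T)
  have hT : T.card ≤ 4 := Finset.card_le_four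
  have hQ : Q.ones = T.card := by simp [ones, Q]
  refine not_isLinear_of_crossing (P := Q) hab (a₁ := a₁) (b₁ := b₁) (a₂ := a₂) (b₂ := b₂)
    (by simp [Q, T]) (by simp [Q, T]) (by simp [Q, T]) (by simp [Q, T]) h₁ h₂ h₃
    (hP.isLinear_of_le (fun i j hij => ?_) fun he => ?_)
  · simp only [Q, T, decide_eq_true_eq, Finset.mem_insert, Finset.mem_singleton,
      Prod.mk.injEq] at hij
    rcases hij with ⟨rfl, rfl⟩ | ⟨rfl, rfl⟩ | ⟨rfl, rfl⟩ | ⟨rfl, rfl⟩ <;> assumption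
  · rw [← he, hQ] at hcard
    omega

end ZeroOneMatrix

/-! ### Words without alternations, and the matrix as a word -/

namespace ZeroOneMatrix

/-- A word of length `N ≥ 2` over an alphabet with `k` letters, without alternations `abab`, without
three equal consecutive letters, and neither starting nor ending with two equal letters, has length
at most `4 * k - 4`. -/
theorem word_length_le {k N : ℕ} (hN : 2 ≤ N) (w : ℕ → Fin k)
    (halt : ∀ x y z u, x < y → y < z → z < u → u < N → w x = w z → w y = w u → w x = w y)
    (hthree : ∀ x, x + 2 < N → w x = w (x + 1) → w (x + 1) ≠ w (x + 2))
    (hfirst : w 0 ≠ w 1) (hlast : w (N - 2) ≠ w (N - 1)) : N + 4 ≤ 4 * k := by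
  classical
  let First : ℕ → Prop := fun x => ∀ y < x, w y ≠ w x
  let Rep : ℕ → Prop := fun x => 0 < x ∧ w (x - 1) = w x
  let F := (Finset.range N).filter First
  let T := (Finset.range N).filter Rep
  let G := (Finset.range N).filter fun x => ¬ First x ∧ ¬ Rep x
  have hF : F.card ≤ k := by
    have := Finset.card_le_card_of_injOn (s := F) (t := Finset.univ) w (fun _ _ => by simp)
      (fun x hx y hy hxy => by
        have hx := (Finset.mem_filter.1 hx).2
        have hy := (Finset.mem_filter.1 hy).2
        rcases lt_trichotomy x y with h | h | h
        · exact absurd hxy (hy x h)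
        · exact h
        · exact absurd hxy.symm (hx y h))
    simpa using this
  have h0F : 0 ∈ F := by
    simp only [F, Finset.mem_filter, Finset.mem_range]
    exact ⟨by omega, fun y hy => absurd hy (Nat.not_lt_zero y)⟩
  -- The last occurrence of the letter at `x` before `x`.
  have hprev : ∀ x ∈ G, ∃ p, p + 1 < x ∧ w p = w x ∧ ∀ y, p < y → y < x → w y ≠ w x := by
    intro x hx
    obtain ⟨hxN, hx₁, hx₂⟩ := Finset.mem_filter.1 hx
    simp only [First, not_forall, not_not] at hx₁
    obtain ⟨y, hy, hyx⟩ := hx₁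
    have hne : ((Finset.range x).filter fun p => w p = w x).Nonempty :=
      ⟨y, by simp [hy, hyx]⟩
    have hmem := Finset.max'_mem _ hne
    set p := Finset.max' _ hne with hp
    simp only [Finset.mem_filter, Finset.mem_range] at hmem
    refine ⟨p, ?_, hmem.2, fun z hz hzx hzw => ?_⟩
    · by_contra hc
      have : p = x - 1 := by omega
      exact hx₂ ⟨by omega, this ▸ hmem.2⟩
    · have := Finset.le_max' ((Finset.range x).filter fun p => w p = w x) z (by simp [hzx, hzw])
      omega
  choose! p hp₁ hp₂ hp₃ using hprev
  -- The position just after the previous occurrence of the letter at `x` carries a different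
  -- letter; an earlier occurrence of that letter would create an alternation. So it is a first
  -- occurrence, and not position 0.
  have hG : G.card + 1 ≤ F.card := by
    have : G.card ≤ (F.erase 0).card := by
      refine Finset.card_le_card_of_injOn (fun x => p x + 1) (fun x hx => ?_)
        (fun x hx y hy hxy => ?_)
      · have hx' := Finset.mem_range.1 (Finset.mem_filter.1 hx).1
        have h₁ := hp₁ x hx
        simp only [Finset.coe_erase, Set.mem_sdiff, Finset.mem_coe, Set.mem_singleton_iff]
        refine ⟨Finset.mem_filter.2 ⟨Finset.mem_range.2 (by omega), fun y hy hyw => ?_⟩,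
          Nat.succ_ne_zero _⟩
        have hne : w (p x + 1) ≠ w x := hp₃ x hx _ (by omega) h₁
        rcases (Nat.lt_succ_iff.1 hy).lt_or_eq with h | h
        · have := halt y (p x) (p x + 1) x h (by omega) h₁ hx' hyw (hp₂ x hx)
          exact hne (hyw.symm.trans (this.trans (hp₂ x hx)))
        · exact hne (by rw [← hyw, h, hp₂ x hx])
      · have hxy : p x = p y := by simpa using hxy
        have hw : w x = w y := by rw [← hp₂ x hx, hxy, hp₂ y hy]
        have h₁ := hp₁ x hx
        have h₂ := hp₁ y hy
        rcases lt_trichotomy x y with h | h | h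
        · exact absurd hw (hp₃ y hy x (by omega) h)
        · exact h
        · exact absurd hw.symm (hp₃ x hx y (by omega) h)
    rw [Finset.card_erase_of_mem h0F] at this
    have := Finset.card_pos.2 ⟨0, h0F⟩
    omega
  let R := (Finset.range N).filter fun x => ¬ Rep x
  have hR : R.card ≤ F.card + G.card := by
    refine (Finset.card_le_card fun x hx => ?_).trans (Finset.card_union_le F G)
    obtain ⟨hx, hx'⟩ := Finset.mem_filter.1 hx
    by_cases h : First x
    · exact Finset.mem_union_left _ (Finset.mem_filter.2 ⟨hx, h⟩)
    · exact Finset.mem_union_right _ (Finset.mem_filter.2 ⟨hx, h, hx'⟩)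
  have hTR : T.card + R.card = N := by
    rw [Finset.card_filter_add_card_filter_not, Finset.card_range]
  have h0R : 0 ∈ R := Finset.mem_filter.2 ⟨Finset.mem_range.2 (by omega), fun h => absurd h.1 (lt_irrefl 0)⟩
  have hlR : N - 1 ∈ R.erase 0 := by
    refine Finset.mem_erase.2 ⟨by omega, Finset.mem_filter.2 ⟨Finset.mem_range.2 (by omega), ?_⟩⟩
    rintro ⟨-, h⟩
    exact hlast h
  -- The predecessor of a repetition is not itself a repetition, and is neither the first nor the
  -- last position. Altogether N = T + R ≤ 2R - 2 with R ≤ 2k - 1.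
  have hT : T.card + 2 ≤ R.card := by
    have : T.card ≤ ((R.erase 0).erase (N - 1)).card := by
      refine Finset.card_le_card_of_injOn (fun x => x - 1) (fun x hx => ?_)
        (fun x hx y hy hxy => ?_)
      · obtain ⟨hxN, hx₀, hxw⟩ := Finset.mem_filter.1 hx
        have hxN := Finset.mem_range.1 hxN
        obtain ⟨x, rfl⟩ : ∃ x', x = x' + 1 := ⟨x - 1, by omega⟩
        simp only [Nat.add_sub_cancel] at hxw ⊢
        refine Finset.mem_coe.2 (Finset.mem_erase.2 ⟨by omega, Finset.mem_erase.2 ⟨?_,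
          Finset.mem_filter.2 ⟨Finset.mem_range.2 (by omega), ?_⟩⟩⟩)
        · rintro rfl; exact hfirst hxw
        · rintro ⟨h₀, h⟩
          obtain ⟨x, rfl⟩ : ∃ x', x = x' + 1 := ⟨x - 1, by omega⟩
          exact hthree x hxN h hxw
      · have := (Finset.mem_filter.1 hx).2.1
        have := (Finset.mem_filter.1 hy).2.1
        simp only at hxy
        omega
    rw [Finset.card_erase_of_mem hlR, Finset.card_erase_of_mem h0R] at this
    have h₁ := Finset.card_pos.2 ⟨_, hlR⟩
    rw [Finset.card_erase_of_mem h0R] at h₁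
    omega
  omega

/-- The ones of a matrix can be enumerated column by column, and inside each column by any given
key. -/
theorem exists_enumeration {k l : ℕ} (P : ZeroOneMatrix k l) (key : Fin k → Fin l → ℕ) :
    ∃ (row : Fin P.ones → Fin k) (col : Fin P.ones → Fin l),
      (∀ x, P (row x) (col x) = true) ∧
      (∀ i j, P i j = true → ∃ x, row x = i ∧ col x = j) ∧
      (∀ x y, row x = row y → col x = col y → x = y) ∧
      (∀ x y, x ≤ y → col x ≤ col y) ∧
      ∀ x y, x ≤ y → col x = col y → key (row x) (col x) ≤ key (row y) (col y) := by
  classical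
  let code : Fin k × Fin l → Fin l ×ₗ (ℕ ×ₗ Fin k) :=
    fun p => toLex (p.2, toLex (key p.1 p.2, p.1))
  have hcode : Function.Injective code := by
    rintro ⟨i, j⟩ ⟨i', j'⟩ h
    simp only [code, EmbeddingLike.apply_eq_iff_eq, Prod.mk.injEq] at h
    rw [h.1, h.2.2]
  let E := Finset.univ.filter fun p : Fin k × Fin l => P p.1 p.2 = true
  have hE : (E.image code).card = P.ones := Finset.card_image_of_injective _ hcode
  let e := (E.image code).orderEmbOfFin hE
  have hmem : ∀ x, ∃ p : Fin k × Fin l, P p.1 p.2 = true ∧ code p = e x := fun x => by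
    obtain ⟨p, hp, hpx⟩ := Finset.mem_image.1 (Finset.orderEmbOfFin_mem (E.image code) hE x)
    exact ⟨p, (Finset.mem_filter.1 hp).2, hpx⟩
  choose p hp hpe using hmem
  have hle : ∀ x y, x ≤ y → code (p x) ≤ code (p y) := fun x y h => by
    rw [hpe, hpe]; exact e.monotone h
  refine ⟨fun x => (p x).1, fun x => (p x).2, hp, fun i j hij => ?_, fun x y h₁ h₂ => ?_,
    fun x y h => ?_, fun x y h h' => ?_⟩
  · have : code (i, j) ∈ Set.range e := by
      rw [Finset.range_orderEmbOfFin]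
      simpa [E] using ⟨i, j, hij, rfl⟩
    obtain ⟨x, hx⟩ := this
    have := hcode ((hpe x).trans hx)
    exact ⟨x, congrArg Prod.fst this, congrArg Prod.snd this⟩
  · refine e.injective ?_
    rw [← hpe, ← hpe, Prod.ext h₁ h₂]
  · exact Prod.Lex.monotone_fst _ _ (hle x y h)
  · have h₁ := hle x y h
    simp only [code, Prod.Lex.toLex_le_toLex] at h₁
    rcases h₁ with h₁ | ⟨-, h₁ | ⟨h₁, -⟩⟩
    · exact absurd h' h₁.ne
    · exact h₁.le
    · exact h₁.le

/-- A matrix none of whose pairs of rows alternate, and in which the ones of a row are sufficiently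
separated by ones of other rows, has at most `4 * k - 4` ones. -/
theorem ones_add_four_le {k l : ℕ} {P : ZeroOneMatrix k l} (hcard : 2 ≤ P.ones)
    (hcross : ∀ a b, a ≠ b → ∀ a₁ b₁ a₂ b₂, P a a₁ = true → P b b₁ = true → P a a₂ = true →
      P b b₂ = true → a₁ ≤ b₁ → b₁ < a₂ → a₂ ≤ b₂ → False)
    (hbetween : ∀ a c₁ c₂ c₃, c₁ < c₂ → c₂ < c₃ → P a c₁ = true → P a c₂ = true →
      P a c₃ = true → ∃ i j, c₁ < j ∧ j < c₃ ∧ P i j = true ∧ i ≠ a)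
    (hfirst : ∀ a c₀ c₁, c₀ < c₁ → P a c₀ = true → P a c₁ = true →
      ∃ i j, j < c₁ ∧ P i j = true ∧ i ≠ a)
    (hlast : ∀ a c₀ c₁, c₁ < c₀ → P a c₀ = true → P a c₁ = true →
      ∃ i j, c₁ < j ∧ P i j = true ∧ i ≠ a) : P.ones + 4 ≤ 4 * k := by
  classical
  -- Within a column, rows that end there are listed before rows that continue to the right.
  obtain ⟨row, col, hone, hsurj, hinj, hcol, hkey⟩ := exists_enumeration P
    fun i j => if ∃ j', j < j' ∧ P i j' = true then 1 else 0
  have hlt : ∀ x y, x < y → row x = row y → col x < col y := fun x y h h' =>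
    (hcol x y h.le).lt_of_ne fun h'' => h.ne (hinj x y h' h'')
  have hpos : ∀ x y, col x < col y → x < y := fun x y h => by
    by_contra! hc
    exact absurd (hcol y x hc) (not_le.2 h)
  have h0 : 0 < P.ones := by omega
  let w : ℕ → Fin k := fun x => if h : x < P.ones then row ⟨x, h⟩ else row ⟨0, h0⟩
  have hw : ∀ x (h : x < P.ones), w x = row ⟨x, h⟩ := fun x h => dif_pos h
  refine word_length_le hcard w ?_ ?_ ?_ ?_
  · intro x y z u hxy hyz hzu hu h₁ h₂
    rw [hw x (by omega), hw z (by omega)] at h₁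
    rw [hw y (by omega), hw u hu] at h₂
    rw [hw x (by omega), hw y (by omega)]
    by_contra hne
    generalize hX : (⟨x, by omega⟩ : Fin P.ones) = X at *
    generalize hY : (⟨y, by omega⟩ : Fin P.ones) = Y at *
    generalize hZ : (⟨z, by omega⟩ : Fin P.ones) = Z at *
    generalize hU : (⟨u, by omega⟩ : Fin P.ones) = U at *
    have hXY : X < Y := by subst hX hY; exact hxy
    have hYZ : Y < Z := by subst hY hZ; exact hyz
    have hZU : Z < U := by subst hZ hU; exact hzu
    have hXZ := hlt X Z (hXY.trans hYZ) h₁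
    have hYU := hlt Y U (hYZ.trans hZU) h₂
    have p₁ := hone X
    have p₂ := hone Y
    have p₃ := hone Z
    have p₄ := hone U
    rw [← h₁] at p₃
    rw [← h₂] at p₄
    rcases (hcol Y Z hYZ.le).lt_or_eq with h | h
    · exact hcross _ _ hne _ _ _ _ p₁ p₂ p₃ p₄ (hcol X Y hXY.le) h (hcol Z U hZU.le)
    -- Two middle letters in one column: the row of `Y` continues to `U`, so by the key the row of
    -- `Z` continues as well. Whichever continuation comes first, the two rows form a degenerate
    -- alternation starting in this column.
    · have hk := hkey Y Z hYZ.le h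
      rw [if_pos ⟨_, hYU, p₄⟩] at hk
      split_ifs at hk with hZ'
      · obtain ⟨c, hc, hcP⟩ := hZ'
        rw [← h₁] at hcP
        rcases le_total c (col U) with h' | h'
        · exact hcross _ _ hne _ _ _ _ p₃ p₂ hcP p₄ h.ge (h ▸ hc) h'
        · exact hcross _ _ (Ne.symm hne) _ _ _ _ p₂ p₃ p₄ hcP h.le (h ▸ hYU) h'
      · omega
  · intro x hx h₁ h₂
    rw [hw x (by omega), hw (x + 1) (by omega)] at h₁
    rw [hw (x + 1) (by omega), hw (x + 2) hx] at h₂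
    obtain ⟨i, j, hj₁, hj₂, hij, hi⟩ := hbetween (row ⟨x, by omega⟩) (col ⟨x, by omega⟩)
      (col ⟨x + 1, by omega⟩) (col ⟨x + 2, hx⟩) (hlt _ _ (Fin.mk_lt_mk.2 (by omega)) h₁)
      (hlt _ _ (Fin.mk_lt_mk.2 (by omega)) h₂) (hone _) (by rw [h₁]; exact hone _)
      (by rw [h₁, h₂]; exact hone _)
    obtain ⟨y, rfl, rfl⟩ := hsurj i j hij
    have hy₁ := Fin.lt_def.1 (hpos _ _ hj₁)
    have hy₂ := Fin.lt_def.1 (hpos _ _ hj₂)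
    have : y = ⟨x + 1, by omega⟩ := Fin.ext (by simp only at hy₁ hy₂ ⊢; omega)
    exact hi (by rw [this, h₁])
  · intro h₁
    rw [hw 0 (by omega), hw 1 (by omega)] at h₁
    obtain ⟨i, j, hj, hij, hi⟩ := hfirst (row ⟨0, by omega⟩) (col ⟨0, by omega⟩)
      (col ⟨1, by omega⟩) (hlt _ _ (Fin.mk_lt_mk.2 (by omega)) h₁) (hone _)
      (by rw [h₁]; exact hone _)
    obtain ⟨y, rfl, rfl⟩ := hsurj i j hij
    have hy := Fin.lt_def.1 (hpos _ _ hj)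
    have : y = ⟨0, by omega⟩ := Fin.ext (by simp only at hy ⊢; omega)
    exact hi (by rw [this])
  · intro h₁
    rw [hw (P.ones - 2) (by omega), hw (P.ones - 1) (by omega)] at h₁
    obtain ⟨i, j, hj, hij, hi⟩ := hlast (row ⟨P.ones - 1, by omega⟩) (col ⟨P.ones - 1, by omega⟩)
      (col ⟨P.ones - 2, by omega⟩) (hlt _ _ (Fin.mk_lt_mk.2 (by omega)) h₁) (hone _)
      (h₁ ▸ hone _)
    obtain ⟨y, rfl, rfl⟩ := hsurj i j hij
    have hy := Fin.lt_def.1 (hpos _ _ hj)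
    have : y = ⟨P.ones - 1, by omega⟩ := Fin.ext (by have := y.2; simp only at hy ⊢; omega)
    exact hi (by rw [this])

end ZeroOneMatrix

theorem mainTheorem1 (k l : ℕ) (P : ZeroOneMatrix k l)
    (hP : ZeroOneMatrix.IsMinimallyNonlinear P) :
    (ZeroOneMatrix.ones P : ℤ) ≤ 4 * (k : ℤ) - 4 := by
  by_contra! hlt
  have hlin : ¬ P.IsLinear := fun h => h.not_isSuperlinear hP.1
  -- With two rows the bound is at least 4, so a counterexample has more than four ones, as
  -- `not_crossing` requires.
  have hk : 2 ≤ k := by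
    by_contra! hk
    exact hlin (ZeroOneMatrix.isLinear_of_rows_le_one (by omega) P)
  have hcard : 4 < P.ones := by omega
  have hle : P.ones + 4 ≤ 4 * k := by
    refine ZeroOneMatrix.ones_add_four_le (by omega) ?_ ?_ ?_ ?_
    · intro a b hab a₁ b₁ a₂ b₂ ha₁ hb₁ ha₂ hb₂
      exact hP.not_crossing hcard hab ha₁ hb₁ ha₂ hb₂
    · intro a c₁ c₂ c₃ h₁₂ h₂₃ h₁ h₂ h₃
      by_contra! hc
      exact hlin (ZeroOneMatrix.isLinear_of_erase_between h₁₂ h₂₃ h₁ h₃ hc (hP.isLinear_erase h₂))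
    · intro a c₀ c₁ h₀₁ h₀ h₁
      by_contra! hc
      exact hlin (ZeroOneMatrix.isLinear_of_erase_first h₀₁ h₁ hc (hP.isLinear_erase h₀))
    · intro a c₀ c₁ h₀₁ h₀ h₁
      by_contra! hc
      exact hlin (ZeroOneMatrix.isLinear_of_erase_last h₀₁ h₁ hc (hP.isLinear_erase h₀))
  omega
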